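/- Let $n\ge 0$ and let $A=(a_{i,j})$ be a real $n\times n$ matrix such that $a_{i,i}>0$ for all $i$, $a_{i,j}<0$ for all $i\ne j$, and $\sum_{j=1}^n a_{i,j}>0$ for all $i$. Write $[n]=\{1,\dots,n\}$, let $\mathbf e_1,\dots,\mathbf e_n$ be the standard basis of $\mathbb R^n$, let $C_A=\prod_{i=1}^n[0,a_{i,i}]$, and let \[ F_A=\overline{\,C_A\setminus\bigcup_{\emptyset\ne S\subseteq[n]}\Big\{x+\sum_{i\in S}A\mathbf e_i : x\in C_A\Big\}}\subseteq\mathbb R^n , \] a (not necessarily convex) axis-aligned polytope. A vertex of $F_A$ is a zero-dimensional face, that is, a point $\mathbf v\in F_A$ such that there is no nonzero direction $\mathbf w$ along which $F_A$ is translation invariant near $\mathbf v$ (meaning that, for some neighbourhood $U$ of $\mathbf v$, whenever $x\in U$, $t\in\mathbb R$ and $x+t\mathbf w\in U$, one has $x\in F_A$ if and only if $x+t\mathbf w\in F_A$). Let $\operatorname{OPP}(n)$ be the set of ordered partial partitions on $[n]$, that is, of relations $\preccurlyeq$ on $[n]$ that are transitive, weakly reflexive (if $x\preccurlyeq y$ then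 $x\preccurlyeq x$ and $y\preccurlyeq y$) and weakly connected (if $x\preccurlyeq x$ and $y\preccurlyeq y$ then $x\preccurlyeq y$ or $y\preccurlyeq x$). Then the vertices of $F_A$ are in bijective correspondence with the elements of $\operatorname{OPP}(n)$, where the vertex $\mathbf v$ corresponding to $\preccurlyeq$ has the coordinates \[ v_i=\sum_{j\,:\,i\preccurlyeq j}a_{i,j}\qquad\text{for all }1\le i\le n . \] -/

import Mathlib

namespace DetPolytope

/-- The cuboid `C_A = ∏ i, [0, a_{i,i}]` in `ℝⁿ` (only the topology of `ℝⁿ` is used). -/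
def cuboid {n : ℕ} (A : Matrix (Fin n) (Fin n) ℝ) : Set (Fin n → ℝ) :=
  Set.univ.pi fun i => Set.Icc 0 (A i i)

/-- The set `F_A`: the closure of what remains of the cuboid `C_A` after removing its translates
by the sums of the columns `A e_i`, `i ∈ S`, over all nonempty sets `S` of indices. -/
def FA {n : ℕ} (A : Matrix (Fin n) (Fin n) ℝ) : Set (Fin n → ℝ) :=
  closure (cuboid A \ ⋃ (S : Finset (Fin n)) (_ : S.Nonempty),
    (fun x => x + ∑ i ∈ S, A.mulVec (Pi.single i 1)) '' cuboid A)

/-- Near the point `v`, the set `F` is invariant under translation in the direction `w`. -/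
def LocallyInvariantAt {n : ℕ} (F : Set (Fin n → ℝ)) (v w : Fin n → ℝ) : Prop :=
  ∃ U ∈ nhds v, ∀ x ∈ U, ∀ t : ℝ, x + t • w ∈ U → (x ∈ F ↔ x + t • w ∈ F)

/-- Vertices of a polytope `F` that need not be convex. The face of `F` that contains a point `v`
in its relative interior is parallel to the space of directions along which `F` is invariant
near `v`; the vertices are the points where this space is zero, that is, the zero-dimensional
faces. (For convex polytopes these are the extreme points; reentrant corners count as well.) -/
def IsVertex {n : ℕ} (F : Set (Fin n → ℝ)) (v : Fin n → ℝ) : Prop :=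
  v ∈ F ∧ ∀ w, LocallyInvariantAt F v w → w = 0

/-- Ordered partial partitions on `[n]`: transitive, weakly reflexive, weakly connected
relations. -/
@[ext]
structure OPP (n : ℕ) where
  rel : Fin n → Fin n → Prop
  trans : ∀ x y z, rel x y → rel y z → rel x z
  weakly_refl : ∀ x y, rel x y → rel x x ∧ rel y y
  weakly_connected : ∀ x y, rel x x → rel y y → rel x y ∨ rel y x

end DetPolytope

/-!
Write `u S i = ∑ j ∈ S, A i j`. For `i ∈ S` this is positive and strictly antitone in `S`.
If `x` lies in the cuboid and `S` is maximal among the nonempty sets with `u S i ≤ x i` for all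
`i ∈ S`, then `x` lies in the translate belonging to `S`; shrinking towards the origin then shows
that `F_A` consists of the `x ≥ 0` such that every nonempty `S` contains an `i` with `x i ≤ u S i`
(`mem_FA_iff`).

Fix `v ∈ F_A`. Near `v` only the *saturated* sets matter, the nonempty `S` with `u S i ≤ v i` for
all `i ∈ S`, and each constrains only its *tight* indices, the `i ∈ S` with `v i = u S i`.
Applying `mem_FA_iff` to the union of two saturated sets shows that the saturated sets form a chain
(`Saturated.subset_or_subset`) and that an index tight for `T` belongs only to the saturated sets
containing `T` (`Tight.subset`), so it is tight for `T` alone. Hence, near `v`, the set `F_A` is a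
product of half-lines (the `i` with `v i = 0`), of sets `{y | ∃ i ∈ t, y i ≤ v i}` with `t` the
tight indices of a saturated set, and of lines. So `v` is a vertex iff there are no lines, that is,
iff each `i` has `v i = 0` or is tight for some saturated set (`isVertex_iff`).

For such a `v`, the relation "`i` is tight for some saturated set containing `j`" is an ordered
partial partition. Its up-sets are the saturated sets having tight indices, which gives the formula
for the coordinates; conversely, the up-sets of any ordered partial partition are saturated for the
point it defines.
-/

namespace DetPolytope

open Filter Topology

variable {n : ℕ} {A : Matrix (Fin n) (Fin n) ℝ} {v : Fin n → ℝ}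

/-! ### Partial row sums -/

/-- The sum of the entries of row `i` in the columns of `S`, which is also the `i`-th coordinate
of the translation vector `∑ j ∈ S, A e_j`. -/
def rowSum (A : Matrix (Fin n) (Fin n) ℝ) (S : Finset (Fin n)) (i : Fin n) : ℝ := ∑ j ∈ S, A i j

theorem sum_mulVec_single (S : Finset (Fin n)) :
    ∑ i ∈ S, A.mulVec (Pi.single i 1) = rowSum A S := by
  ext k
  simp [rowSum, Finset.sum_apply]

theorem rowSum_anti (hoff : ∀ i j, i ≠ j → A i j < 0) {S T : Finset (Fin n)} {i : Fin n}
    (hST : S ⊆ T) (hi : i ∈ S) : rowSum A T i ≤ rowSum A S i := by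
  unfold rowSum
  rw [← Finset.sum_sdiff hST]
  have : ∑ j ∈ T \ S, A i j ≤ 0 := Finset.sum_nonpos fun j hj =>
    (hoff i j fun h => (Finset.mem_sdiff.1 hj).2 (h ▸ hi)).le
  linarith

theorem subset_of_rowSum_le (hoff : ∀ i j, i ≠ j → A i j < 0) {S T : Finset (Fin n)} {i : Fin n}
    (hST : S ⊆ T) (hi : i ∈ S) (h : rowSum A S i ≤ rowSum A T i) : T ⊆ S := by
  intro k hk
  by_contra hkS
  have h1 := rowSum_anti hoff (Finset.subset_insert k S) hi
  have h2 := rowSum_anti hoff (Finset.insert_subset hk hST) (Finset.mem_insert_of_mem hi)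
  have h3 : rowSum A (insert k S) i = A i k + rowSum A S i := Finset.sum_insert hkS
  have h4 := hoff i k (fun h => hkS (h ▸ hi))
  linarith

theorem rowSum_pos (hoff : ∀ i j, i ≠ j → A i j < 0) (hrow : ∀ i, 0 < ∑ j, A i j)
    {S : Finset (Fin n)} {i : Fin n} (hi : i ∈ S) : 0 < rowSum A S i :=
  (hrow i).trans_le (rowSum_anti hoff (Finset.subset_univ S) hi)

theorem rowSum_nonpos (hoff : ∀ i j, i ≠ j → A i j < 0)
    {S : Finset (Fin n)} {i : Fin n} (hi : i ∉ S) : rowSum A S i ≤ 0 :=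
  Finset.sum_nonpos fun j hj => (hoff i j fun h => hi (h ▸ hj)).le

/-! ### Inequalities describing the polytope -/

theorem mem_cuboid_diff_iff (hoff : ∀ i j, i ≠ j → A i j < 0) (hrow : ∀ i, 0 < ∑ j, A i j)
    (x : Fin n → ℝ) :
    x ∈ cuboid A \ ⋃ (S : Finset (Fin n)) (_ : S.Nonempty),
        (fun x => x + ∑ i ∈ S, A.mulVec (Pi.single i 1)) '' cuboid A ↔
      x ∈ cuboid A ∧ ∀ S : Finset (Fin n), S.Nonempty → ∃ i ∈ S, x i < rowSum A S i := by
  rw [Set.mem_sdiff]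
  refine and_congr_right fun hx => ?_
  simp only [sum_mulVec_single, Set.mem_iUnion, Set.mem_image, not_exists, not_and]
  simp only [cuboid, Set.mem_univ_pi, Set.mem_Icc] at hx ⊢
  constructor
  · intro h S₀ hS₀
    by_contra! hcon
    obtain ⟨S, hle, hmax⟩ := (Set.toFinite {S : Finset (Fin n) |
      ∀ i ∈ S, rowSum A S i ≤ x i}).exists_le_maximal (a := S₀) hcon
    have hS : ∀ i ∈ S, rowSum A S i ≤ x i := hmax.prop
    refine h S (hS₀.mono hle) (x - rowSum A S) (fun i => ?_) (sub_add_cancel _ _)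
    rw [Pi.sub_apply]
    by_cases hi : i ∈ S
    · have := rowSum_pos hoff hrow hi
      exact ⟨by linarith [hS i hi], by linarith [(hx i).2]⟩
    · refine ⟨by linarith [(hx i).1, rowSum_nonpos hoff hi], ?_⟩
      by_contra! hlt
      have hins : ∀ k ∈ insert i S, rowSum A (insert i S) k ≤ x k := by
        intro k hk
        rcases Finset.mem_insert.1 hk with rfl | hk
        · have : rowSum A (insert k S) k = A k k + rowSum A S k := Finset.sum_insert hi
          linarith
        · exact (rowSum_anti hoff (Finset.subset_insert i S) hk).trans (hS k hk)
      exact hi (hmax.le_of_ge hins (Finset.subset_insert i S) (Finset.mem_insert_self i S))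
  · intro h S hS y hy hyx
    obtain ⟨i, _, hlt⟩ := h S hS
    have : y i + rowSum A S i = x i := congrFun hyx i
    linarith [(hy i).1]

theorem mem_FA_iff (hoff : ∀ i j, i ≠ j → A i j < 0) (hrow : ∀ i, 0 < ∑ j, A i j)
    (x : Fin n → ℝ) :
    x ∈ FA A ↔ (∀ i, 0 ≤ x i) ∧
      ∀ S : Finset (Fin n), S.Nonempty → ∃ i ∈ S, x i ≤ rowSum A S i := by
  constructor
  · intro hx
    have hcl : IsClosed {x : Fin n → ℝ | (∀ i, 0 ≤ x i) ∧
        ∀ S : Finset (Fin n), S.Nonempty → ∃ i ∈ S, x i ≤ rowSum A S i} := by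
      have h1 : IsClosed {x : Fin n → ℝ | ∀ i, 0 ≤ x i} := by
        simp only [Set.ofPred_forall]
        exact isClosed_iInter fun i => isClosed_le continuous_const (continuous_apply i)
      have h2 : IsClosed {x : Fin n → ℝ |
          ∀ S : Finset (Fin n), S.Nonempty → ∃ i ∈ S, x i ≤ rowSum A S i} := by
        simp only [Set.ofPred_forall]
        refine isClosed_iInter fun S => isClosed_iInter fun _ => ?_
        have : {x : Fin n → ℝ | ∃ i ∈ S, x i ≤ rowSum A S i} =
            ⋃ i ∈ S, {x : Fin n → ℝ | x i ≤ rowSum A S i} := by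
          ext; simp
        rw [this]
        exact S.finite_toSet.isClosed_biUnion fun i _ =>
          isClosed_le (continuous_apply i) continuous_const
      exact h1.inter h2
    refine closure_minimal (fun y hy => ?_) hcl hx
    obtain ⟨hy, h⟩ := (mem_cuboid_diff_iff hoff hrow y).1 hy
    refine ⟨fun i => (hy i trivial).1, fun S hS => ?_⟩
    obtain ⟨i, hi, hlt⟩ := h S hS
    exact ⟨i, hi, hlt.le⟩
  · rintro ⟨hx, h⟩
    -- `x` is the limit of its multiples `c • x` with `c < 1`, which satisfy strict inequalities.
    have hlim : Tendsto (fun c : ℝ => c • x) (𝓝[<] 1) (𝓝 x) := by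
      have : Tendsto (fun c : ℝ => c • x) (𝓝 1) (𝓝 ((1 : ℝ) • x)) :=
        (continuous_id.smul continuous_const).tendsto 1
      rw [one_smul] at this
      exact this.mono_left nhdsWithin_le_nhds
    refine mem_closure_of_tendsto hlim ?_
    filter_upwards [Ioo_mem_nhdsLT (zero_lt_one' ℝ)] with c hc
    rw [mem_cuboid_diff_iff hoff hrow]
    refine ⟨fun i _ => ⟨mul_nonneg hc.1.le (hx i), ?_⟩, fun S hS => ?_⟩
    · obtain ⟨k, hk, hle⟩ := h {i} (Finset.singleton_nonempty i)
      obtain rfl := Finset.mem_singleton.1 hk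
      have hle : x k ≤ A k k := by simpa [rowSum] using hle
      exact (mul_le_of_le_one_left (hx k) hc.2.le).trans hle
    · obtain ⟨i, hi, hle⟩ := h S hS
      refine ⟨i, hi, (mul_le_mul_of_nonneg_left hle hc.1.le).trans_lt ?_⟩
      exact mul_lt_of_lt_one_left (rowSum_pos hoff hrow hi) hc.2

/-! ### Saturated sets and tight indices -/

/-- A nonempty set `S` of indices is saturated at `v` if no `i ∈ S` satisfies the inequality
`v i ≤ ∑ j ∈ S, A i j` strictly. The other sets impose no condition on the points of `F_A`
near `v`. -/
def Saturated (A : Matrix (Fin n) (Fin n) ℝ) (v : Fin n → ℝ) (S : Finset (Fin n)) : Prop :=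
  S.Nonempty ∧ ∀ i ∈ S, rowSum A S i ≤ v i

/-- The index `i` is tight for `S` at `v` if `S` is saturated and `v i` attains the bound that `S`
gives for it. -/
def Tight (A : Matrix (Fin n) (Fin n) ℝ) (v : Fin n → ℝ) (S : Finset (Fin n)) (i : Fin n) : Prop :=
  Saturated A v S ∧ i ∈ S ∧ v i = rowSum A S i

theorem Saturated.exists_tight {S : Finset (Fin n)}
    (hv : ∀ S : Finset (Fin n), S.Nonempty → ∃ i ∈ S, v i ≤ rowSum A S i)
    (hS : Saturated A v S) : ∃ i, Tight A v S i := by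
  obtain ⟨i, hi, hle⟩ := hv S hS.1
  exact ⟨i, hS, hi, hle.antisymm (hS.2 i hi)⟩

theorem Saturated.subset_or_subset (hoff : ∀ i j, i ≠ j → A i j < 0)
    (hv : ∀ S : Finset (Fin n), S.Nonempty → ∃ i ∈ S, v i ≤ rowSum A S i)
    {S T : Finset (Fin n)} (hS : Saturated A v S) (hT : Saturated A v T) : T ⊆ S ∨ S ⊆ T := by
  obtain ⟨k, hk, hle⟩ := hv (S ∪ T) (hS.1.mono Finset.subset_union_left)
  rcases Finset.mem_union.1 hk with hk | hk
  · exact .inl (Finset.subset_union_right.trans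
      (subset_of_rowSum_le hoff Finset.subset_union_left hk ((hS.2 k hk).trans hle)))
  · exact .inr (Finset.subset_union_left.trans
      (subset_of_rowSum_le hoff Finset.subset_union_right hk ((hT.2 k hk).trans hle)))

theorem Tight.subset (hoff : ∀ i j, i ≠ j → A i j < 0)
    (hv : ∀ S : Finset (Fin n), S.Nonempty → ∃ i ∈ S, v i ≤ rowSum A S i)
    {S T : Finset (Fin n)} {i : Fin n} (hT : Tight A v T i) (hS : Saturated A v S) (hi : i ∈ S) :
    T ⊆ S :=
  (hS.subset_or_subset hoff hv hT.1).elim id fun h =>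
    subset_of_rowSum_le hoff h hi ((hS.2 i hi).trans hT.2.2.le)

theorem Tight.unique (hoff : ∀ i j, i ≠ j → A i j < 0)
    (hv : ∀ S : Finset (Fin n), S.Nonempty → ∃ i ∈ S, v i ≤ rowSum A S i)
    {S T : Finset (Fin n)} {i : Fin n} (hT : Tight A v T i) (hS : Tight A v S i) : T = S :=
  (hT.subset hoff hv hS.1 hS.2.1).antisymm (hS.subset hoff hv hT.1 hT.2.1)

/-! ### Local structure and vertices -/

/-- If the `i`-th coordinate of `v` meets none of the bounds that matter near `v`, then `F_A` is
invariant near `v` in the direction of the `i`-th basis vector. -/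
theorem locallyInvariantAt_single (hoff : ∀ i j, i ≠ j → A i j < 0)
    (hrow : ∀ i, 0 < ∑ j, A i j) {i : Fin n} (h0 : 0 < v i) (ht : ∀ S, ¬ Tight A v S i) :
    LocallyInvariantAt (FA A) v (Pi.single i 1) := by
  have hnear : ∀ᶠ x in 𝓝 v, 0 < x i ∧ ∀ (S : Finset (Fin n)) (j : Fin n),
      (v j < rowSum A S j → x j < rowSum A S j) ∧ (rowSum A S j < v j → rowSum A S j < x j) := by
    have hc : ∀ j, Tendsto (fun x : Fin n → ℝ => x j) (𝓝 v) (𝓝 (v j)) := fun j =>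
      (continuous_apply j).tendsto v
    refine ((hc i).eventually_const_lt h0).and (eventually_all.2 fun S => eventually_all.2 fun j =>
      .and ?_ ?_)
    · exact eventually_imp_distrib_left.2 fun h => (hc j).eventually_lt_const h
    · exact eventually_imp_distrib_left.2 fun h => (hc j).eventually_const_lt h
  have key : ∀ x y : Fin n → ℝ, (∀ j, j ≠ i → y j = x j) →
      (∀ (S : Finset (Fin n)) (j : Fin n), rowSum A S j < v j → rowSum A S j < x j) →
      (0 < y i ∧ ∀ (S : Finset (Fin n)) (j : Fin n), v j < rowSum A S j → y j < rowSum A S j) →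
      x ∈ FA A → y ∈ FA A := by
    rintro x y hxy hx ⟨hy0, hy⟩ hxF
    rw [mem_FA_iff hoff hrow] at hxF ⊢
    refine ⟨fun j => ?_, fun S hS => ?_⟩
    · by_cases hj : j = i
      · exact hj ▸ hy0.le
      · exact hxy j hj ▸ hxF.1 j
    · by_cases hsat : Saturated A v S
      · obtain ⟨j, hj, hle⟩ := hxF.2 S hS
        refine ⟨j, hj, ?_⟩
        by_cases hji : j = i
        · subst hji
          refine absurd (hx S j (lt_of_le_of_ne (hsat.2 j hj) fun h => ?_)) hle.not_gt
          exact ht S ⟨hsat, hj, h.symm⟩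
        · exact hxy j hji ▸ hle
      · have : ∃ j ∈ S, v j < rowSum A S j := by
          by_contra! hcon
          exact hsat ⟨hS, hcon⟩
        obtain ⟨j, hj, hlt⟩ := this
        exact ⟨j, hj, (hy S j hlt).le⟩
  refine ⟨_, hnear, fun x hx t hxt => ?_⟩
  have hne : ∀ j, j ≠ i → (x + t • (Pi.single i 1 : Fin n → ℝ)) j = x j := fun j hj => by simp [hj]
  exact ⟨key _ _ hne (fun S j => (hx.2 S j).2) ⟨hxt.1, fun S j => (hxt.2 S j).1⟩,
    key _ _ (fun j hj => (hne j hj).symm) (fun S j => (hxt.2 S j).2)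
      ⟨hx.1, fun S j => (hx.2 S j).1⟩⟩

/-- Local invariance is refuted by a point of `F` and a point outside `F` found one after the
other: `x ∈ F` near `v`, then `x + t • w ∉ F` for arbitrarily small `t`. -/
theorem not_locallyInvariantAt {F : Set (Fin n → ℝ)} {w : Fin n → ℝ}
    (h : ∃ᶠ x in 𝓝 v, x ∈ F ∧ ∃ᶠ t : ℝ in 𝓝 0, x + t • w ∉ F) : ¬ LocallyInvariantAt F v w := by
  rintro ⟨U, hU, hinv⟩
  obtain ⟨x, ⟨hxF, hx⟩, hxU⟩ := (h.and_eventually (eventually_mem_nhds_iff.2 hU)).exists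
  have hlim : Tendsto (fun t : ℝ => x + t • w) (𝓝 0) (𝓝 x) := by
    have : Continuous fun t : ℝ => x + t • w := by fun_prop
    simpa using this.tendsto 0
  obtain ⟨t, ht, htU⟩ := (hx.and_eventually (hlim hxU)).exists
  exact ht ((hinv x (mem_of_mem_nhds hxU) t htU).1 hxF)

theorem frequently_mul_pos {a : ℝ} (ha : a ≠ 0) : ∃ᶠ t : ℝ in 𝓝 0, 0 < t * a := by
  rcases lt_or_gt_of_ne ha with ha | ha
  · have : ∃ᶠ t : ℝ in 𝓝[<] 0, t < 0 :=
      Eventually.frequently (f := 𝓝[<] (0 : ℝ)) eventually_mem_nhdsWithin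
    exact (this.filter_mono nhdsWithin_le_nhds).mono fun t ht => mul_pos_of_neg_of_neg ht ha
  · have : ∃ᶠ t : ℝ in 𝓝[>] 0, 0 < t :=
      Eventually.frequently (f := 𝓝[>] (0 : ℝ)) eventually_mem_nhdsWithin
    exact (this.filter_mono nhdsWithin_le_nhds).mono fun t ht => mul_pos ht ha

theorem not_locallyInvariantAt_of_eq_zero (hoff : ∀ i j, i ≠ j → A i j < 0)
    (hrow : ∀ i, 0 < ∑ j, A i j) (hv : v ∈ FA A) {w : Fin n → ℝ} {i : Fin n} (hw : w i ≠ 0)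
    (h0 : v i = 0) : ¬ LocallyInvariantAt (FA A) v w := by
  have hout : ∃ᶠ t : ℝ in 𝓝 0, v + t • w ∉ FA A := by
    refine (frequently_mul_pos (neg_ne_zero.2 hw)).mono fun t ht hmem => ?_
    have h1 : 0 ≤ v i + t * w i := ((mem_FA_iff hoff hrow _).1 hmem).1 i
    linarith
  exact not_locallyInvariantAt (mem_closure_iff_frequently.1 (subset_closure ⟨hv, hout⟩))

theorem not_locallyInvariantAt_of_tight (hoff : ∀ i j, i ≠ j → A i j < 0)
    (hrow : ∀ i, 0 < ∑ j, A i j) (hv : v ∈ FA A) {w : Fin n → ℝ} {i : Fin n} (hw : w i ≠ 0)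
    {S : Finset (Fin n)} (hS : Tight A v S i) : ¬ LocallyInvariantAt (FA A) v w := by
  classical
  obtain ⟨hv0, hvS⟩ := (mem_FA_iff hoff hrow v).1 hv
  -- Raising the tight indices of `S` other than `i` leaves `i` as the only reason why the
  -- condition for `S` holds; the other saturated sets have other tight indices.
  let d : Fin n → ℝ := fun j => if Tight A v S j ∧ j ≠ i then 1 else 0
  have hd0 : ∀ j, 0 ≤ d j := fun j => by
    simp only [d]
    split_ifs <;> norm_num
  have hlim : Tendsto (fun ε : ℝ => v + ε • d) (𝓝[>] 0) (𝓝 v) := by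
    have : Continuous fun ε : ℝ => v + ε • d := by fun_prop
    have h0 : Tendsto (fun ε : ℝ => v + ε • d) (𝓝 0) (𝓝 v) := by simpa using this.tendsto 0
    exact h0.mono_left nhdsWithin_le_nhds
  have hnear : ∀ᶠ x in 𝓝 v, ∀ (T : Finset (Fin n)) (j : Fin n),
      v j < rowSum A T j → x j < rowSum A T j :=
    eventually_all.2 fun T => eventually_all.2 fun j => eventually_imp_distrib_left.2 fun h =>
      ((continuous_apply j).tendsto v).eventually_lt_const h
  refine not_locallyInvariantAt (hlim.frequently (Eventually.frequently ?_))
  filter_upwards [hlim.eventually hnear, eventually_mem_nhdsWithin] with ε hε hpos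
  have hpos : 0 < ε := hpos
  refine ⟨(mem_FA_iff hoff hrow _).2 ⟨fun j => ?_, fun T hT => ?_⟩, ?_⟩
  · exact add_nonneg (hv0 j) (mul_nonneg hpos.le (hd0 j))
  · by_cases hsat : Saturated A v T
    · by_cases hTS : T = S
      · subst hTS
        exact ⟨i, hS.2.1, by simp [d, hS.2.2]⟩
      · obtain ⟨k, hk⟩ := hsat.exists_tight hvS
        have : ¬ Tight A v S k := fun h => hTS (hk.unique hoff hvS h)
        exact ⟨k, hk.2.1, by simp [d, this, hk.2.2]⟩
    · have : ∃ j ∈ T, v j < rowSum A T j := by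
        by_contra! hcon
        exact hsat ⟨hT, hcon⟩
      obtain ⟨j, hj, hlt⟩ := this
      exact ⟨j, hj, (hε T j hlt).le⟩
  · have hothers : ∀ᶠ t : ℝ in 𝓝 0, ∀ j ∈ S, j ≠ i → rowSum A S j < v j + ε * d j + t * w j := by
      refine eventually_all.2 fun j => eventually_imp_distrib_left.2 fun hj =>
        eventually_imp_distrib_left.2 fun hji => ?_
      have hc : Continuous fun t : ℝ => v j + ε * d j + t * w j := by fun_prop
      refine (hc.tendsto 0).eventually_const_lt ?_
      rw [zero_mul, add_zero]
      rcases (hS.1.2 j hj).lt_or_eq with hlt | heq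
      · linarith [mul_nonneg hpos.le (hd0 j)]
      · have : d j = 1 := if_pos ⟨⟨hS.1, hj, heq.symm⟩, hji⟩
        rw [this]
        linarith
    refine ((frequently_mul_pos hw).and_eventually hothers).mono fun t ⟨hti, ht⟩ hmem => ?_
    obtain ⟨j, hj, hle⟩ := ((mem_FA_iff hoff hrow _).1 hmem).2 S hS.1.1
    refine hle.not_gt ?_
    by_cases hji : j = i
    · subst hji
      simpa [d, hS.2.2] using hti
    · exact ht j hj hji

theorem isVertex_iff (hoff : ∀ i j, i ≠ j → A i j < 0) (hrow : ∀ i, 0 < ∑ j, A i j) :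
    IsVertex (FA A) v ↔ v ∈ FA A ∧ ∀ i, v i = 0 ∨ ∃ S, Tight A v S i := by
  refine and_congr_right fun hv => ⟨fun h i => ?_, fun h w hw => ?_⟩
  · by_contra! hcon
    have h0 : 0 < v i := (((mem_FA_iff hoff hrow v).1 hv).1 i).lt_of_ne' hcon.1
    have := congrFun (h _ (locallyInvariantAt_single hoff hrow h0 hcon.2)) i
    simp at this
  · ext i
    by_contra hwi
    rcases h i with h0 | ⟨S, hS⟩
    · exact not_locallyInvariantAt_of_eq_zero hoff hrow hv hwi h0 hw
    · exact not_locallyInvariantAt_of_tight hoff hrow hv hwi hS hw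

/-! ### Vertices and ordered partial partitions -/

/-- The set of all `j` with `i ≼ j`; it is empty if `i` is not in the domain of `≼`. -/
noncomputable def OPP.up (r : OPP n) (i : Fin n) : Finset (Fin n) :=
  open Classical in Finset.univ.filter fun j => r.rel i j

theorem OPP.mem_up {r : OPP n} {i j : Fin n} : j ∈ r.up i ↔ r.rel i j := by
  simp [OPP.up]

/-- The point with coordinates `∑ j with i ≼ j, A i j`. -/
noncomputable def OPP.point (A : Matrix (Fin n) (Fin n) ℝ) (r : OPP n) : Fin n → ℝ :=
  fun i => rowSum A (r.up i) i

theorem OPP.point_eq_zero {r : OPP n} {i : Fin n} (hi : ¬ r.rel i i) : r.point A i = 0 := by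
  have : r.up i = ∅ := Finset.eq_empty_of_forall_notMem fun j hj =>
    hi (r.weakly_refl i j (OPP.mem_up.1 hj)).1
  simp [OPP.point, this, rowSum]

theorem OPP.tight_up (hoff : ∀ i j, i ≠ j → A i j < 0) {r : OPP n} {i : Fin n} (hi : r.rel i i) :
    Tight A (r.point A) (r.up i) i := by
  have hmem : i ∈ r.up i := OPP.mem_up.2 hi
  refine ⟨⟨⟨i, hmem⟩, fun j hj => ?_⟩, hmem, rfl⟩
  rw [OPP.mem_up] at hj
  exact rowSum_anti hoff (fun k hk => OPP.mem_up.2 (r.trans _ _ _ hj (OPP.mem_up.1 hk)))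
    (OPP.mem_up.2 (r.weakly_refl _ _ hj).2)

/-- A nonempty set of indices in the domain of `≼` has a least element, as `≼` restricts to a
total preorder there. -/
theorem OPP.exists_least (r : OPP n) {S : Finset (Fin n)} (hS : S.Nonempty)
    (h : ∀ i ∈ S, r.rel i i) : ∃ i ∈ S, ∀ j ∈ S, r.rel i j := by
  obtain ⟨i, hi, hmax⟩ := S.exists_max_image (fun i => (r.up i).card) hS
  refine ⟨i, hi, fun j hj => ?_⟩
  rcases r.weakly_connected i j (h i hi) (h j hj) with hij | hji
  · exact hij
  · have hsub : r.up i ⊆ r.up j := fun k hk =>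
      OPP.mem_up.2 (r.trans _ _ _ hji (OPP.mem_up.1 hk))
    have := Finset.eq_of_subset_of_card_le hsub (hmax j hj)
    exact OPP.mem_up.1 (this ▸ OPP.mem_up.2 (h j hj))

theorem OPP.point_mem_FA (hoff : ∀ i j, i ≠ j → A i j < 0) (hrow : ∀ i, 0 < ∑ j, A i j)
    (r : OPP n) : r.point A ∈ FA A := by
  refine (mem_FA_iff hoff hrow _).2 ⟨fun i => ?_, fun S hS => ?_⟩
  · by_cases hi : r.rel i i
    · exact (rowSum_pos hoff hrow (OPP.mem_up.2 hi)).le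
    · exact (OPP.point_eq_zero hi).ge
  · by_cases h : ∀ i ∈ S, r.rel i i
    · obtain ⟨i, hi, hle⟩ := r.exists_least hS h
      exact ⟨i, hi, rowSum_anti hoff (fun j hj => OPP.mem_up.2 (hle j hj)) hi⟩
    · push Not at h
      obtain ⟨i, hi, hni⟩ := h
      exact ⟨i, hi, (OPP.point_eq_zero hni).trans_le (rowSum_pos hoff hrow hi).le⟩

theorem OPP.isVertex_point (hoff : ∀ i j, i ≠ j → A i j < 0) (hrow : ∀ i, 0 < ∑ j, A i j)
    (r : OPP n) : IsVertex (FA A) (r.point A) := by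
  refine (isVertex_iff hoff hrow).2 ⟨r.point_mem_FA hoff hrow, fun i => ?_⟩
  by_cases hi : r.rel i i
  · exact .inr ⟨_, OPP.tight_up hoff hi⟩
  · exact .inl (OPP.point_eq_zero hi)

/-- The relation can be recovered from its point, because the set for which an index is tight is
unique. -/
theorem OPP.rel_iff_tight (hoff : ∀ i j, i ≠ j → A i j < 0) (hrow : ∀ i, 0 < ∑ j, A i j)
    (r : OPP n) (i j : Fin n) : r.rel i j ↔ ∃ S, Tight A (r.point A) S i ∧ j ∈ S := by
  have hv := ((mem_FA_iff hoff hrow _).1 (r.point_mem_FA hoff hrow)).2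
  constructor
  · intro h
    exact ⟨_, OPP.tight_up hoff (r.weakly_refl _ _ h).1, OPP.mem_up.2 h⟩
  · rintro ⟨S, hS, hj⟩
    by_cases hi : r.rel i i
    · exact OPP.mem_up.1 (hS.unique hoff hv (OPP.tight_up hoff hi) ▸ hj)
    · have := rowSum_pos hoff hrow hS.2.1
      rw [← hS.2.2, OPP.point_eq_zero hi] at this
      exact absurd this (lt_irrefl 0)

theorem OPP.point_injective (hoff : ∀ i j, i ≠ j → A i j < 0) (hrow : ∀ i, 0 < ∑ j, A i j) :
    Function.Injective (OPP.point A : OPP n → Fin n → ℝ) := by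
  intro r s h
  ext i j
  rw [r.rel_iff_tight hoff hrow, s.rel_iff_tight hoff hrow, h]

theorem exists_point_eq (hoff : ∀ i j, i ≠ j → A i j < 0) (hrow : ∀ i, 0 < ∑ j, A i j)
    (h : IsVertex (FA A) v) : ∃ r : OPP n, r.point A = v := by
  obtain ⟨hvF, hcov⟩ := (isVertex_iff hoff hrow).1 h
  have hv := ((mem_FA_iff hoff hrow _).1 hvF).2
  let r : OPP n :=
    { rel := fun i j => ∃ S, Tight A v S i ∧ j ∈ S
      trans := by
        rintro i j k ⟨S, hS, hj⟩ ⟨T, hT, hk⟩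
        exact ⟨S, hS, hT.subset hoff hv hS.1 hj hk⟩
      weakly_refl := by
        rintro i j ⟨S, hS, hj⟩
        refine ⟨⟨S, hS, hS.2.1⟩, ?_⟩
        have hpos : 0 < v j := (rowSum_pos hoff hrow hj).trans_le (hS.1.2 j hj)
        obtain ⟨T, hT⟩ := (hcov j).resolve_left hpos.ne'
        exact ⟨T, hT, hT.2.1⟩
      weakly_connected := by
        rintro i j ⟨S, hS, _⟩ ⟨T, hT, _⟩
        exact (hS.1.subset_or_subset hoff hv hT.1).imp (fun h => ⟨S, hS, h hT.2.1⟩)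
          (fun h => ⟨T, hT, h hS.2.1⟩) }
  refine ⟨r, funext fun i => ?_⟩
  rcases hcov i with h0 | ⟨S, hS⟩
  · rw [h0]
    refine OPP.point_eq_zero ?_
    rintro ⟨S, hS, hi⟩
    exact (rowSum_pos hoff hrow hi).ne' (hS.2.2.symm.trans h0)
  · have : r.up i = S := by
      ext j
      rw [OPP.mem_up]
      exact ⟨fun ⟨T, hT, hj⟩ => hT.unique hoff hv hS ▸ hj, fun hj => ⟨S, hS, hj⟩⟩
    rw [OPP.point, this, hS.2.2]

end DetPolytope

open Classical in
theorem proposition4p4 (n : ℕ) (A : Matrix (Fin n) (Fin n) ℝ)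
    (hdiag : ∀ i, 0 < A i i)
    (hoff : ∀ i j, i ≠ j → A i j < 0)
    (hrow : ∀ i, 0 < ∑ j, A i j) :
    ∃ e : DetPolytope.OPP n ≃ {v : Fin n → ℝ // DetPolytope.IsVertex (DetPolytope.FA A) v},
      ∀ (r : DetPolytope.OPP n) (i : Fin n),
        (e r : Fin n → ℝ) i = ∑ j ∈ Finset.univ.filter (fun j => r.rel i j), A i j := by
  refine ⟨Equiv.ofBijective (fun r => ⟨r.point A, r.isVertex_point hoff hrow⟩) ⟨?_, ?_⟩, ?_⟩
  · exact fun r s h => DetPolytope.OPP.point_injective hoff hrow (congrArg Subtype.val h)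
  · rintro ⟨v, hv⟩
    obtain ⟨r, hr⟩ := DetPolytope.exists_point_eq hoff hrow hv
    exact ⟨r, Subtype.ext hr⟩
  · exact fun r i => rfl
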